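/- Let $p$ be a prime number, let $E=\mathbb Q(\sqrt{-p})$, and let $\mathbb A_{E,f}$ be the ring of finite adeles of $E$. Let $n\ge 1$ be an integer and let $K$ be an open compact subgroup of $\mathrm{GL}_n(\mathbb A_{E,f})$. Then the determinant induces a well-defined bijection of double coset spaces $$\det:\ \mathrm{GL}_n(E)\backslash \mathrm{GL}_n(\mathbb A_{E,f})/K\ \longrightarrow\ E^\times\backslash \mathbb A_{E,f}^\times/\det(K),\qquad \mathrm{GL}_n(E)\,g\,K\ \longmapsto\ E^\times \det(g)\det(K).$$ -/

import Mathlib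

open scoped NumberField MatrixGroups

/-- The square root `√p · i` of `-p` in `ℂ`. -/
noncomputable def sqrtNeg (p : ℕ) : ℂ := (Real.sqrt p : ℂ) * Complex.I

theorem sqrtNeg_sq (p : ℕ) : sqrtNeg p ^ 2 = -(p : ℂ) := by
  have h : ((Real.sqrt p : ℂ)) ^ 2 = (p : ℂ) := by
    rw [← Complex.ofReal_pow, Real.sq_sqrt (Nat.cast_nonneg p), Complex.ofReal_natCast]
  rw [sqrtNeg, mul_pow, h, Complex.I_sq, mul_neg_one]

/-- The field `ℚ(√-p)`, realised as a subfield of `ℂ`. -/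
noncomputable abbrev QSqrtNeg (p : ℕ) : IntermediateField ℚ ℂ :=
  IntermediateField.adjoin ℚ {sqrtNeg p}

theorem isIntegral_sqrtNeg (p : ℕ) : IsIntegral ℚ (sqrtNeg p) := by
  have h : IsIntegral ℚ (-(p : ℂ)) := (isIntegral_algebraMap (R := ℚ) (x := (p : ℚ))).neg
  rw [← sqrtNeg_sq] at h
  exact h.of_pow two_pos

instance instNumberFieldQSqrtNeg (p : ℕ) : NumberField (QSqrtNeg p) where
  to_charZero := inferInstance
  to_finiteDimensional := IntermediateField.adjoin.finiteDimensional (isIntegral_sqrtNeg p)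

/-- The ring `𝔸_{E,f}` of finite adeles of `E = ℚ(√-p)`. -/
abbrev FinAdele (p : ℕ) : Type :=
  IsDedekindDomain.FiniteAdeleRing (𝓞 (QSqrtNeg p)) (QSqrtNeg p)

/-- `GL_n(E)`, diagonally embedded as a subgroup of `GL_n(𝔸_{E,f})`. -/
noncomputable def rationalGL (p n : ℕ) : Subgroup (GL (Fin n) (FinAdele p)) :=
  (Matrix.GeneralLinearGroup.map (algebraMap (QSqrtNeg p) (FinAdele p))).range

/-- `E^×`, diagonally embedded as a subgroup of `𝔸_{E,f}^×`. -/
noncomputable def rationalUnits (p : ℕ) : Subgroup (FinAdele p)ˣ :=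
  (Units.map (algebraMap (QSqrtNeg p) (FinAdele p) : QSqrtNeg p →* FinAdele p)).range

/-- `GL_n(E) \ GL_n(𝔸_{E,f}) / K`. -/
abbrev GLDoubleCosets (p n : ℕ) (K : Subgroup (GL (Fin n) (FinAdele p))) : Type :=
  DoubleCoset.Quotient (rationalGL p n : Set (GL (Fin n) (FinAdele p))) (K : Set _)

/-- `E^× \ 𝔸_{E,f}^× / U`. -/
abbrev UnitDoubleCosets (p : ℕ) (U : Subgroup (FinAdele p)ˣ) : Type :=
  DoubleCoset.Quotient (rationalUnits p : Set (FinAdele p)ˣ) (U : Set _)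

/-! Surjectivity is that of `det` on `GL_n` for `n ≥ 1`. Injectivity is strong approximation for
`SL_n`: once determinants are matched by a rational matrix, the discrepancy between two
representatives has determinant one, so it is a limit of rational matrices, and openness of `K` lets
a rational matrix replace it.

Strong approximation has two inputs. The finite adeles have stable range one (`hasStableRangeOne`),
so their matrices of determinant one are products of transvections (`detOneFromTransvections`). The
field is dense in its finite adeles (`denseRange_algebraMap`), so each transvection is a limit of
rational ones. -/

/-- A commutative ring has stable range one if, whenever `a` and `b` generate the unit ideal,
some `a + t * b` is a unit. -/
def HasStableRangeOne (R : Type*) [CommRing R] : Prop :=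
  ∀ a b x y : R, a * x + b * y = 1 → ∃ t, IsUnit (a + t * b)

/-! ### Generation of `SL_n` by transvections under stable range one -/

namespace Matrix

variable {R : Type*} [CommRing R]

/-- Every matrix of determinant one lies in each submonoid containing the transvections. -/
def DetOneFromTransvections (R : Type*) [CommRing R] (ι : Type*) [Fintype ι] [DecidableEq ι] :
    Prop :=
  ∀ S : Submonoid (Matrix ι ι R), (∀ i j, i ≠ j → ∀ c, transvection i j c ∈ S) →
    ∀ M : Matrix ι ι R, M.det = 1 → M ∈ S

theorem DetOneFromTransvections.of_equiv {ι κ : Type*} [Fintype ι] [DecidableEq ι] [Fintype κ]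
    [DecidableEq κ] (e : ι ≃ κ) (h : DetOneFromTransvections R ι) :
    DetOneFromTransvections R κ := by
  intro S hS M hM
  have key := h (S.comap (reindexAlgEquiv ℤ R e : Matrix ι ι R →* Matrix κ κ R))
    (fun i j hij c => by
      have := hS (e i) (e j) (e.injective.ne hij) c
      rw [Submonoid.mem_comap]
      convert this using 1
      simpa [TransvectionStruct.toMatrix, TransvectionStruct.reindexEquiv] using
        (TransvectionStruct.toMatrix_reindexEquiv e ⟨i, j, hij, c⟩).symm)
    (M.submatrix e e) (by rw [det_submatrix_equiv_self, hM])
  rw [Submonoid.mem_comap] at key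
  convert key using 1
  ext i j
  simp

variable {ι : Type*} [Fintype ι] [DecidableEq ι]

theorem fromBlocks_one_zero_mem (S : Submonoid (Matrix (Unit ⊕ ι) (Unit ⊕ ι) R))
    (hS : ∀ i j, i ≠ j → ∀ c, transvection i j c ∈ S) (C : Matrix ι Unit R) :
    fromBlocks 1 0 C 1 ∈ S := by
  induction C using Matrix.induction_on' with
  | h_zero => rw [fromBlocks_one]; exact S.one_mem
  | h_add p q hp hq => simpa [fromBlocks_multiply] using S.mul_mem hp hq
  | h_std_basis i j x =>
    convert hS (Sum.inr i) (Sum.inl j) (by simp) x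
    ext (a | a) (b | b) <;> simp [transvection, single_apply, one_apply]

theorem fromBlocks_one_mem (S : Submonoid (Matrix (Unit ⊕ ι) (Unit ⊕ ι) R))
    (hS : ∀ i j, i ≠ j → ∀ c, transvection i j c ∈ S) (B : Matrix Unit ι R) :
    fromBlocks 1 B 0 1 ∈ S := by
  induction B using Matrix.induction_on' with
  | h_zero => rw [fromBlocks_one]; exact S.one_mem
  | h_add p q hp hq => simpa [fromBlocks_multiply] using S.mul_mem hq hp
  | h_std_basis i j x =>
    convert hS (Sum.inl i) (Sum.inr j) (by simp) x
    ext (a | a) (b | b) <;> simp [transvection, single_apply, one_apply]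

theorem mem_of_lower_mul_mem {S : Submonoid (Matrix (Unit ⊕ ι) (Unit ⊕ ι) R)}
    (hS : ∀ i j, i ≠ j → ∀ c, transvection i j c ∈ S) (C : Matrix ι Unit R)
    {M : Matrix (Unit ⊕ ι) (Unit ⊕ ι) R} (h : fromBlocks 1 0 C 1 * M ∈ S) : M ∈ S := by
  have := S.mul_mem (fromBlocks_one_zero_mem S hS (-C)) h
  rwa [← mul_assoc, fromBlocks_multiply, show fromBlocks _ _ _ _ =
    (1 : Matrix (Unit ⊕ ι) (Unit ⊕ ι) R) by simp, one_mul] at this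

theorem mem_of_upper_mul_mem {S : Submonoid (Matrix (Unit ⊕ ι) (Unit ⊕ ι) R)}
    (hS : ∀ i j, i ≠ j → ∀ c, transvection i j c ∈ S) (B : Matrix Unit ι R)
    {M : Matrix (Unit ⊕ ι) (Unit ⊕ ι) R} (h : fromBlocks 1 B 0 1 * M ∈ S) : M ∈ S := by
  have := S.mul_mem (fromBlocks_one_mem S hS (-B)) h
  rwa [← mul_assoc, fromBlocks_multiply, show fromBlocks _ _ _ _ =
    (1 : Matrix (Unit ⊕ ι) (Unit ⊕ ι) R) by simp, one_mul] at this

/-- The case of a pivot equal to one. -/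
theorem mem_of_pivot_eq_one (hι : DetOneFromTransvections R ι)
    {S : Submonoid (Matrix (Unit ⊕ ι) (Unit ⊕ ι) R)}
    (hS : ∀ i j, i ≠ j → ∀ c, transvection i j c ∈ S)
    (B : Matrix Unit ι R) (C : Matrix ι Unit R) (D : Matrix ι ι R)
    (hdet : (fromBlocks 1 B C D).det = 1) : fromBlocks 1 B C D ∈ S := by
  have hD : (D - C * B).det = 1 := by rwa [det_fromBlocks_one₁₁] at hdet
  -- The Schur complement gives the factorization lower · diag(1, D - CB) · upper.
  have hblock : fromBlocks 1 0 0 (D - C * B) ∈ S := by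
    let φ : Matrix ι ι R →* Matrix (Unit ⊕ ι) (Unit ⊕ ι) R :=
      { toFun := fun N => fromBlocks 1 0 0 N
        map_one' := fromBlocks_one
        map_mul' := fun N N' => by simp [fromBlocks_multiply] }
    refine hι (S.comap φ) (fun i j hij c => ?_) _ hD
    rw [Submonoid.mem_comap]
    convert hS (Sum.inr i) (Sum.inr j) (by simpa using hij) c using 1
    ext (a | a) (b | b) <;> simp [φ, transvection, single_apply, one_apply]
  have := S.mul_mem (S.mul_mem (fromBlocks_one_zero_mem S hS C) hblock)
    (fromBlocks_one_mem S hS B)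
  simpa [fromBlocks_multiply] using this

/-- The first column is unimodular, so stable range one makes its top entry a unit by a row
operation. Two more operations turn that unit into 1, without needing diagonal matrices. -/
theorem DetOneFromTransvections.unit_sum (hR : HasStableRangeOne R)
    (hι : DetOneFromTransvections R ι) : DetOneFromTransvections R (Unit ⊕ ι) := by
  intro S hS M hM
  rcases isEmpty_or_nonempty ι with hE | ⟨⟨i₀⟩⟩
  · have : Unique (Unit ⊕ ι) := (Equiv.sumEmpty Unit ι).unique
    rw [det_unique] at hM
    have : M = 1 := by
      ext a b
      rw [Subsingleton.elim a default, Subsingleton.elim b default, hM, one_apply_eq]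
    exact this ▸ S.one_mem
  obtain ⟨A, B, C, D, rfl⟩ : ∃ A B C D, M = fromBlocks A B C D :=
    ⟨_, _, _, _, (fromBlocks_toBlocks M).symm⟩
  obtain ⟨X, hX⟩ : ∃ X : Matrix Unit ι R, IsUnit (A + X * C) := by
    obtain ⟨P, Q, P', Q', hN⟩ : ∃ P Q P' Q', (fromBlocks A B C D).adjugate = fromBlocks P Q P' Q' :=
      ⟨_, _, _, _, (fromBlocks_toBlocks _).symm⟩
    have h := adjugate_mul (fromBlocks A B C D)
    rw [hM, one_smul, hN, fromBlocks_multiply, ← fromBlocks_one, fromBlocks_inj] at h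
    have h₁ := congrFun (congrFun h.1 ()) ()
    -- The first column of `adjugate * M = 1` reads `P * A + Q * C = 1`; the Bézout pair is `A` and
    -- `Q * C`.
    obtain ⟨t, ht⟩ := hR (A () ()) ((Q * C) () ()) (P () ()) 1 (by
      simpa [mul_apply, mul_comm] using h₁)
    refine ⟨t • Q, ?_⟩
    rw [isUnit_iff_isUnit_det, det_unique]
    simpa using ht
  obtain ⟨V, hV⟩ := hX.exists_left_inv
  set e : Matrix ι Unit R := single i₀ () 1
  have he : eᵀ * e = 1 := by
    ext
    simp [e]
  -- Make the pivot a unit, use it to turn the column below into `e`, then use the entry 1 of `e` to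
  -- make the pivot 1.
  apply mem_of_upper_mul_mem hS X
  apply mem_of_lower_mul_mem hS ((e - C) * V)
  apply mem_of_upper_mul_mem hS ((1 - (A + X * C)) * eᵀ)
  have hdet : (fromBlocks 1 ((1 - (A + X * C)) * eᵀ) 0 1 * (fromBlocks 1 0 ((e - C) * V) 1 *
      (fromBlocks 1 X 0 1 * fromBlocks A B C D))).det = 1 := by
    simp only [det_mul, det_fromBlocks_zero₂₁, det_fromBlocks_zero₁₂, det_one, hM, one_mul]
  have hcol : (e - C) * V * (A + X * C) + C = e := by
    rw [Matrix.mul_assoc, hV, Matrix.mul_one, sub_add_cancel]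
  have hpivot : A + X * C + (1 - (A + X * C)) * eᵀ * e = 1 := by
    rw [Matrix.mul_assoc, he, Matrix.mul_one, add_sub_cancel]
  simp only [fromBlocks_multiply, Matrix.one_mul, Matrix.zero_mul, zero_add, add_zero, hcol,
    hpivot] at hdet ⊢
  exact mem_of_pivot_eq_one hι hS _ _ _ hdet

theorem detOneFromTransvections (hR : HasStableRangeOne R) (n : ℕ) :
    DetOneFromTransvections R (Fin n) := by
  induction n with
  | zero =>
    intro S _ M _
    rw [Subsingleton.elim M 1]
    exact S.one_mem
  | succ n ih =>
    exact (ih.unit_sum hR).of_equiv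
      ((Equiv.sumComm _ _).trans ((Equiv.optionEquivSumPUnit _).symm.trans (finSuccEquiv n).symm))

end Matrix

/-! ### Stable range one and common denominators for finite adeles -/

namespace IsDedekindDomain.FiniteAdeleRing

open HeightOneSpectrum

variable {R : Type*} [CommRing R] [IsDedekindDomain R] {K : Type*} [Field K] [Algebra R K]
  [IsFractionRing R K]

theorem hasStableRangeOne : HasStableRangeOne (FiniteAdeleRing R K) := by
  classical
  intro a b x y h
  have hv : ∀ v, a v * x v + b v * y v = 1 := fun v =>
    congrArg (fun z : FiniteAdeleRing R K => z v) h
  -- At a place where everything is integral, `|a| < 1` forces `|b| = 1`, so `a + b` is a local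
  -- unit; if `|a| = 1`, then `t = 0` works. At the other places a nonzero value suffices.
  let t : FiniteAdeleRing R K := ⟨fun v => if Valued.v (a v) < 1 ∧ a v + b v ≠ 0 then 1
    else if a v = 0 then 1 else 0, Filter.Eventually.of_forall fun v => by
      dsimp only
      split_ifs <;> simp⟩
  have ht : ∀ v, t v = if Valued.v (a v) < 1 ∧ a v + b v ≠ 0 then 1
    else if a v = 0 then 1 else 0 := fun v => rfl
  have hval : ∀ v, (a + t * b) v = a v + t v * b v := fun v => rfl
  refine ⟨t, isUnit_iff.2 ⟨fun v => ?_, ?_⟩⟩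
  · rw [hval, ht]
    have := hv v
    split_ifs with h₁ h₂
    · simpa using h₁.2
    · rintro h₃
      simp_all
    · simpa using h₂
  · filter_upwards [a.2, b.2, x.2, y.2] with v ha hb hx hy
    rw [SetLike.mem_coe, mem_adicCompletionIntegers] at ha hb hx hy
    change Valued.v (a v) ≤ 1 at ha
    change Valued.v (b v) ≤ 1 at hb
    change Valued.v (x v) ≤ 1 at hx
    change Valued.v (y v) ≤ 1 at hy
    rw [hval, ht]
    rcases ha.lt_or_eq with ha | ha
    · have hb1 : Valued.v (b v) = 1 := by
        refine le_antisymm hb (not_lt.1 fun hlt => ?_)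
        have h₁ : Valued.v (a v * x v) < 1 := by
          rw [map_mul]; exact mul_lt_one_of_lt_of_le ha hx
        have h₂ : Valued.v (b v * y v) < 1 := by
          rw [map_mul]; exact mul_lt_one_of_lt_of_le hlt hy
        have := Valuation.map_add_lt _ h₁ h₂
        rw [hv, map_one] at this
        exact this.false
      have hab : Valued.v (a v + b v) = 1 := by
        rw [Valuation.map_add_eq_of_lt_right _ (by rwa [hb1]), hb1]
      have hne : a v + b v ≠ 0 := fun h0 => by simp [h0] at hab
      simp [ha, hne, hab]
    · have hne : a v ≠ 0 := fun h0 => by simp [h0] at ha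
      simp [ha, hne]

theorem exists_algebraMap_mul_mem (a : FiniteAdeleRing R K) :
    ∃ d : R, d ≠ 0 ∧ ∀ v, (algebraMap R (FiniteAdeleRing R K) d * a) v ∈
      v.adicCompletionIntegers K := by
  classical
  have hfin : {v | a v ∉ v.adicCompletionIntegers K}.Finite := a.2
  choose b hb hab using fun v : HeightOneSpectrum R =>
    adicCompletion.mul_nonZeroDivisor_mem_adicCompletionIntegers v (a v)
  refine ⟨∏ v ∈ hfin.toFinset, b v,
    Finset.prod_ne_zero_iff.2 fun v _ => nonZeroDivisors.ne_zero (hb v), fun v => ?_⟩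
  have heq (d : R) : (algebraMap R (FiniteAdeleRing R K) d * a) v =
      algebraMap R (v.adicCompletion K) d * a v := rfl
  rw [heq]
  by_cases hv : a v ∈ v.adicCompletionIntegers K
  · exact mul_mem (coe_mem_adicCompletionIntegers v _) hv
  · rw [← Finset.prod_erase_mul _ _ (hfin.mem_toFinset.2 hv), map_mul, mul_assoc,
      mul_comm (algebraMap R _ (b v))]
    exact mul_mem (coe_mem_adicCompletionIntegers v _) (hab v)

end IsDedekindDomain.FiniteAdeleRing

/-! ### Density of a Dedekind domain in its integral adeles -/

namespace IsDedekindDomain.HeightOneSpectrum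

variable {R : Type*} [CommRing R] [IsDedekindDomain R] {K : Type*} [Field K] [Algebra R K]
  [IsFractionRing R K]

open WithZero

theorem exists_exp_ball_subset {v : HeightOneSpectrum R} {x : v.adicCompletion K}
    {s : Set (v.adicCompletion K)} (hs : s ∈ nhds x) :
    ∃ n : ℕ, {y | Valued.v (y - x) ≤ exp (-n : ℤ)} ⊆ s := by
  obtain ⟨γ, hγ⟩ := Valued.mem_nhds.1 hs
  obtain ⟨m, hm⟩ : ∃ m : ℤ, exp m = MonoidWithZeroHom.ValueGroup₀.embedding γ.1 :=
    ⟨_, exp_log (by simp)⟩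
  -- This exponent gives `-n < m` whatever the sign of `m`.
  refine ⟨m.natAbs + 1, fun y hy => hγ ?_⟩
  rw [Set.mem_ofPred_eq] at hy ⊢
  rw [Valuation.restrict_lt_iff_lt_embedding, ← hm]
  refine hy.trans_lt (exp_lt_exp.2 ?_)
  omega

theorem exp_ball_mem_nhds {v : HeightOneSpectrum R} (x : v.adicCompletion K) (n : ℤ) :
    {y | Valued.v (y - x) < exp n} ∈ nhds x := by
  obtain ⟨z, hz⟩ := valuedAdicCompletion_surjective K v (exp n)
  refine Valued.mem_nhds.2 ⟨Units.mk0 (Valued.v.restrict z) ?_, fun y hy => ?_⟩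
  · simp [← Valuation.ne_zero_iff (Valued.v (R := v.adicCompletion K)), hz]
  · rw [Set.mem_ofPred_eq] at hy ⊢
    rwa [Units.val_mk0, Valuation.restrict_lt_iff, hz] at hy

theorem exists_valued_algebraMap_sub_lt (v : HeightOneSpectrum R) {x : v.adicCompletion K}
    (hx : x ∈ v.adicCompletionIntegers K) (n : ℕ) :
    ∃ r : R, Valued.v (algebraMap R (v.adicCompletion K) r - x) < exp (-n : ℤ) := by
  obtain ⟨_, hk, k, rfl⟩ := mem_closure_iff_nhds.1 (denseRange_algebraMap (K := K) v x) _
    (exp_ball_mem_nhds x (-n))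
  rw [Set.mem_ofPred_eq] at hk
  have hle : exp (-n : ℤ) ≤ (1 : ℤᵐ⁰) := by
    rw [← exp_zero, exp_le_exp]
    omega
  -- An approximant in `K` close to an integral `x` is itself integral at `v`, hence approximable
  -- from `R`.
  have hk1 : v.valuation K k ≤ 1 := by
    rw [← valuedAdicCompletion_eq_valuation', ← sub_add_cancel (k : v.adicCompletion K) x]
    exact (Valuation.map_add _ _ _).trans (max_le (hk.le.trans hle) hx)
  obtain ⟨r, hr⟩ := exists_valuation_sub_lt_of_integer v hk1
    (Units.mk0 (exp (-n : ℤ)) exp_ne_zero)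
  refine ⟨r, ?_⟩
  rw [← sub_add_sub_cancel _ (algebraMap K (v.adicCompletion K) k)]
  refine Valuation.map_add_lt _ ?_ hk
  rw [IsScalarTower.algebraMap_apply R K, ← map_sub]
  exact (valuedAdicCompletion_eq_valuation' v _).trans_lt hr

/-- A Dedekind domain is dense in the product of the rings of integers of its completions. -/
theorem denseRange_algebraMap_pi_adicCompletionIntegers :
    DenseRange fun (r : R) (v : HeightOneSpectrum R) =>
      algebraMap R (v.adicCompletionIntegers K) r := by
  classical
  intro x
  refine mem_closure_iff.2 fun o ho hxo => ?_
  obtain ⟨I, u, hu, hsub⟩ := isOpen_pi_iff.1 ho x hxo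
  have hball : ∀ v : HeightOneSpectrum R, ∃ n : ℕ, v ∈ I → ∀ y : v.adicCompletionIntegers K,
      Valued.v (y.1 - (x v).1) ≤ exp (-n : ℤ) → y ∈ u v := by
    intro v
    by_cases hv : v ∈ I
    · obtain ⟨t, ht, hts⟩ := mem_nhds_subtype _ _ _ |>.1 ((hu v hv).1.mem_nhds (hu v hv).2)
      obtain ⟨n, hn⟩ := exists_exp_ball_subset ht
      exact ⟨n, fun _ y hy => hts (hn hy)⟩
    · exact ⟨0, fun h => absurd h hv⟩
  choose n hn using hball
  choose r hr using fun v : HeightOneSpectrum R =>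
    exists_valued_algebraMap_sub_lt v (x v).2 (n v)
  -- Only the finitely many places of `I` matter; the Chinese remainder theorem glues the local
  -- approximants.
  obtain ⟨y, hy⟩ := exists_forall_sub_mem_ideal (s := I) (fun v => v.asIdeal) n
    (fun v _ => v.prime) (fun v _ w _ hvw h => hvw (HeightOneSpectrum.ext h)) (fun v => r v)
  refine ⟨_, hsub fun v hv => hn v hv _ ?_, y, rfl⟩
  have hyr : Valued.v (algebraMap R (v.adicCompletion K) y - algebraMap R _ (r v)) ≤
      exp (-(n v) : ℤ) := by
    rw [← map_sub]
    refine (valuedAdicCompletion_eq_valuation v _).trans_le ?_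
    rw [valuation_of_algebraMap, intValuation_le_pow_iff_mem]
    exact hy v hv
  change Valued.v (algebraMap R (v.adicCompletion K) y - (x v).1) ≤ _
  rw [← sub_add_sub_cancel _ (algebraMap R (v.adicCompletion K) (r v))]
  exact (Valuation.map_add _ _ _).trans (max_le hyr (hr v).le)

end IsDedekindDomain.HeightOneSpectrum

namespace IsDedekindDomain.FiniteAdeleRing

open HeightOneSpectrum

variable {R : Type*} [CommRing R] [IsDedekindDomain R] {K : Type*} [Field K] [Algebra R K]
  [IsFractionRing R K]

/-- Scale `a` by `d` to an integral adele, approximate that from `R`, and divide by `d`. -/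
theorem denseRange_algebraMap : DenseRange (algebraMap K (FiniteAdeleRing R K)) := by
  intro a
  obtain ⟨d, hd, had⟩ := exists_algebraMap_mul_mem a
  let s : (∀ v : HeightOneSpectrum R, v.adicCompletionIntegers K) → FiniteAdeleRing R K :=
    RestrictedProduct.structureMap (fun v : HeightOneSpectrum R => v.adicCompletion K)
      (fun v => (v.adicCompletionIntegers K : Set (v.adicCompletion K))) Filter.cofinite
  have hs : Continuous s := RestrictedProduct.isEmbedding_structureMap.continuous
  have hcont : Continuous fun x => algebraMap K (FiniteAdeleRing R K) (algebraMap R K d)⁻¹ * s x :=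
    hs.const_mul _
  have hmem := map_mem_closure hcont
    (denseRange_algebraMap_pi_adicCompletionIntegers fun v => ⟨_, had v⟩)
    (t := Set.range (algebraMap K (FiniteAdeleRing R K))) ?_
  · convert hmem using 1
    change a = algebraMap K (FiniteAdeleRing R K) (algebraMap R K d)⁻¹ *
      (algebraMap R (FiniteAdeleRing R K) d * a)
    rw [IsScalarTower.algebraMap_apply R K (FiniteAdeleRing R K), ← mul_assoc, ← map_mul, inv_mul_cancel₀, map_one,
      one_mul]
    exact (map_ne_zero_iff _ (IsFractionRing.injective R K)).2 hd
  · rintro _ ⟨r, rfl⟩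
    exact ⟨(algebraMap R K d)⁻¹ * algebraMap R K r, by rw [map_mul]; rfl⟩

end IsDedekindDomain.FiniteAdeleRing

/-! ### Strong approximation and its consequence for double cosets -/

namespace Matrix.GeneralLinearGroup

variable {n : Type*} [Fintype n] [DecidableEq n]

/-- Transvections as elements of the general linear group. -/
def ofTransvection {R : Type*} [CommRing R] {i j : n} (hij : i ≠ j) (c : R) : GL n R where
  val := transvection i j c
  inv := transvection i j (-c)
  val_inv := by simp [transvection_mul_transvection_same _ _ hij]
  inv_val := by simp [transvection_mul_transvection_same _ _ hij]

theorem continuous_ofTransvection {R : Type*} [CommRing R] [TopologicalSpace R]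
    [IsTopologicalRing R] {i j : n} (hij : i ≠ j) :
    Continuous (ofTransvection hij : R → GL n R) := by
  have h : Continuous fun c : R => transvection i j c := by
    refine continuous_matrix fun a b => ?_
    simp only [transvection, add_apply, single_apply]
    split_ifs <;> fun_prop
  exact Units.continuous_iff.2 ⟨h, h.comp continuous_neg⟩

/-- Strong approximation: over a topological ring of stable range one, a matrix of determinant one
is a limit of matrices defined over a dense subring. -/
theorem mem_topologicalClosure_range_map {k A : Type*} [CommRing k] [CommRing A]
    [TopologicalSpace A] [IsTopologicalRing A] (hA : HasStableRangeOne A) {f : k →+* A}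
    (hf : DenseRange f) {m : ℕ} (g : GL (Fin m) A) (hg : det g = 1) :
    g ∈ (map (n := Fin m) f).range.topologicalClosure := by
  have htrans (i j : Fin m) (hij : i ≠ j) (c : A) :
      ofTransvection hij c ∈ (map (n := Fin m) f).range.topologicalClosure := by
    refine map_mem_closure (continuous_ofTransvection hij) (hf c) ?_
    rintro _ ⟨x, rfl⟩
    refine ⟨ofTransvection hij x, Units.ext ?_⟩
    ext a b
    simp [ofTransvection, transvection, single_apply, one_apply, apply_ite f]
  obtain ⟨h, hh, heq⟩ := detOneFromTransvections hA m
    ((map (n := Fin m) f).range.topologicalClosure.toSubmonoid.map (Units.coeHom _))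
    (fun i j hij c => ⟨ofTransvection hij c, htrans i j hij c, rfl⟩) g.1 (congrArg Units.val hg)
  rwa [← Units.ext heq]

/-- Two invertible matrices whose determinants lie in the same double coset lie in the same double
coset themselves. -/
theorem exists_eq_mul_mul_of_det_eq {k A : Type*} [CommRing k] [CommRing A]
    [TopologicalSpace A] [IsTopologicalRing A] (hA : HasStableRangeOne A) {f : k →+* A}
    (hf : DenseRange f) {m : ℕ} [Nonempty (Fin m)] {K : Subgroup (GL (Fin m) A)}
    (hK : IsOpen (K : Set (GL (Fin m) A))) {g h κ : GL (Fin m) A} (hκ : κ ∈ K) (u : kˣ)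
    (hdet : det h = Units.map (f : k →* A) u * det g * det κ) :
    ∃ γ ∈ (map (n := Fin m) f).range, ∃ κ ∈ K, h = γ * g * κ := by
  obtain ⟨δ, rfl⟩ := det_surjective (n := Fin m) u
  have hs : det (h * (map f δ * g * κ)⁻¹) = 1 := by
    rw [map_mul, map_inv, map_mul, map_mul,
      Matrix.GeneralLinearGroup.map_det, hdet, mul_inv_cancel]
  have hmem := mem_topologicalClosure_range_map hA hf _ hs
  have hcont : Continuous fun x : GL (Fin m) A => (map f δ * g)⁻¹ * (x⁻¹ * h) := by
    fun_prop
  -- At `x = h * (map f δ * g * κ)⁻¹` the continuous map takes the value `κ`, so the preimage of `K`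
  -- is an open neighbourhood of that point.
  obtain ⟨x, hx, hxr⟩ := mem_closure_iff.1 hmem _ (hK.preimage hcont) (by
    simpa [mul_assoc] using hκ)
  exact ⟨x * map f δ, mul_mem hxr ⟨δ, rfl⟩, _, hx, by group⟩

end Matrix.GeneralLinearGroup

/-- `K` is compact and open for the standard topology of `GL_n(𝔸_{E,f})`, that of the unit group of
the topological ring of `n × n` matrices. The equation in the conclusion says that the bijection is
the map induced by the determinant (in particular, that this map is well defined). -/
theorem lemma5p1 (p : ℕ) (hp : p.Prime) (n : ℕ) (hn : 1 ≤ n)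
    (K : Subgroup (GL (Fin n) (FinAdele p)))
    (hKo : IsOpen (K : Set (GL (Fin n) (FinAdele p))))
    (hKc : IsCompact (K : Set (GL (Fin n) (FinAdele p)))) :
    ∃ f : GLDoubleCosets p n K →
        UnitDoubleCosets p (K.map Matrix.GeneralLinearGroup.det),
      (∀ g : GL (Fin n) (FinAdele p),
        f (DoubleCoset.mk (rationalGL p n) K g) =
          DoubleCoset.mk (rationalUnits p) (K.map Matrix.GeneralLinearGroup.det)
            (Matrix.GeneralLinearGroup.det g)) ∧
      Function.Bijective f := by
  have : Nonempty (Fin n) := ⟨⟨0, hn⟩⟩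
  have hdet : ∀ γ ∈ rationalGL p n, Matrix.GeneralLinearGroup.det γ ∈ rationalUnits p := by
    rintro _ ⟨δ, rfl⟩
    exact ⟨Matrix.GeneralLinearGroup.det δ,
      (Matrix.GeneralLinearGroup.map_det _ δ).symm⟩
  refine ⟨Quotient.lift (fun g => DoubleCoset.mk (rationalUnits p)
    (K.map Matrix.GeneralLinearGroup.det) (Matrix.GeneralLinearGroup.det g)) ?_,
    fun _ => rfl, ?_, ?_⟩
  · intro g h hgh
    obtain ⟨γ, hγ, k, hk, rfl⟩ := DoubleCoset.rel_iff.1 hgh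
    exact (DoubleCoset.eq _ _ _ _).2 ⟨_, hdet γ hγ, _, ⟨k, hk, rfl⟩, by rw [map_mul, map_mul]⟩
  · intro a b
    induction a, b using Quotient.inductionOn₂ with | _ g h
    intro hgh
    obtain ⟨e, he, _, ⟨k, hk, rfl⟩, heq⟩ := (DoubleCoset.eq _ _ _ _).1 hgh
    obtain ⟨u, rfl⟩ := he
    exact (DoubleCoset.eq _ _ _ _).2 (Matrix.GeneralLinearGroup.exists_eq_mul_mul_of_det_eq
      IsDedekindDomain.FiniteAdeleRing.hasStableRangeOne
      IsDedekindDomain.FiniteAdeleRing.denseRange_algebraMap hKo hk u heq)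
  · intro b
    induction b using Quotient.inductionOn with | _ u
    obtain ⟨g, rfl⟩ := Matrix.GeneralLinearGroup.det_surjective (n := Fin n) u
    exact ⟨DoubleCoset.mk _ _ g, rfl⟩
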